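/- Let $1\le Q\le d$ and $n\ge 1$ be integers. For a partition $\mathcal G$ of $\{1,\dots,d\}$ into exactly $Q$ nonempty groups let $\mathcal U_{\mathcal G}=\{Zv : Z \text{ an assignment matrix of } \mathcal G,\ v\in\mathbb R^Q\}\subset\mathbb R^d$, where an assignment matrix of $\mathcal G$ is a matrix in $\{0,1\}^{d\times Q}$ whose columns are the indicator vectors of the groups of $\mathcal G$ in some order (so $\mathcal U_{\mathcal G}$ is the subspace of vectors that are constant on every group). Let $\mathcal P_Q$ be the set of these partitions and put \[ \mathcal E_1=\{\mathcal U_{\mathcal G} : \mathcal G\in\mathcal P_Q\},\quad \mathcal E_2=\{\mathcal U_{\mathcal G_1}+\mathcal U_{\mathcal G_2} : \mathcal G_1,\mathcal G_2\in\mathcal P_Q\},\quad \mathcal E_3=\{\mathcal U_{\mathcal G_1}+\mathcal U_{\mathcal G_2}+\mathcal U_{\mathcal G_3} : \mathcal G_1,\mathcal G_2,\mathcal G_3\in\mathcal P_Q\}, \] $D=\max_{\mathcal U\in\mathcal E_1}\dim\mathcal U$ and $N=\mathrm{Card}(\mathcal E_1)$. A random vector $x$ in $\mathbb R^d$ is isotropic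 if $\mathbb E[xx^T]=I$, and its sub-gaussian norm is $\|x\|_{\psi_2}=\sup_{\|\theta\|_2=1}\sup_{p\ge 1}p^{-1/2}\big(\mathbb E|\langle x,\theta\rangle|^p\big)^{1/p}$. For every $K\ge 0$ there are constants $C_0,c>0$ depending only on $K$ such that the following holds for all $d,Q,n$ as above. Let $X\in\mathbb R^{n\times d}$ be a random matrix whose rows $x_1,\dots,x_n$ are independent isotropic random vectors with $\|x_i\|_{\psi_2}\le K$ for all $i$, let $\epsilon\ge 0$, and for $p=2,3$ let \[ \delta_p=C_0\sqrt{\frac{pD}{n}}+\sqrt{\frac{1+p\log N}{cn}} . \] Then, with probability at least $1-\exp(-c\epsilon^2n)$, both \[ \frac1{\sqrt n}\max_{\mathcal U\in\mathcal E_2}\|X\Pi_{\mathcal U}\|_2\le 1+\delta_2+\epsilon \quad\text{and}\quad \max_{\mathcal U\in\mathcal E_3}\Big\|I-\frac1n\Pi_{\mathcal U}^TX^TX\Pi_{\mathcal U}\Big\|_2\le 3\max\{\delta_3+\epsilon,(\delta_3+\epsilon)^2\} \] hold, where $\|\cdot\|_2$ is the spectral norm and $\Pi_{\mathcal U}$ is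 a matrix whose columns form any orthonormal basis of $\mathcal U$. -/

import Mathlib

open MeasureTheory ProbabilityTheory
open scoped ENNReal NNReal Matrix.Norms.L2Operator

noncomputable section

namespace ClusteredDesign

/-! ### Subspaces generated by partitions of the features -/

/-- `Z` is an assignment matrix of the partition `G` of the `d` features: its columns are the
indicator vectors of the groups of `G`, listed in some order. -/
def IsAssignmentMatrix {d : ℕ} (G : Finpartition (Finset.univ : Finset (Fin d)))
    (Z : Matrix (Fin d) (Fin G.parts.card) ℝ) : Prop :=
  ∃ e : Fin G.parts.card ≃ {g // g ∈ G.parts},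
    ∀ i q, Z i q = if i ∈ (e q : Finset (Fin d)) then 1 else 0

/-- The vectors `Z v` with `Z` an assignment matrix of `G` are exactly the vectors that are constant
on every group of `G`. -/
theorem exists_assignment_iff {d : ℕ} (G : Finpartition (Finset.univ : Finset (Fin d)))
    (w : EuclideanSpace ℝ (Fin d)) :
    (∃ Z, IsAssignmentMatrix G Z ∧ ∃ v : Fin G.parts.card → ℝ, ∀ i, w i = (Z.mulVec v) i) ↔
      ∀ g ∈ G.parts, ∀ i ∈ g, ∀ j ∈ g, w i = w j := by
  have key : ∀ (e : Fin G.parts.card ≃ {g // g ∈ G.parts}) (v : Fin G.parts.card → ℝ)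
      (q : Fin G.parts.card) (i : Fin d), i ∈ (e q : Finset (Fin d)) →
      (∑ q', (if i ∈ (e q' : Finset (Fin d)) then (1 : ℝ) else 0) * v q') = v q := by
    intro e v q i hi
    rw [Finset.sum_eq_single q]
    · simp [hi]
    · intro q' _ hne
      have : i ∉ (e q' : Finset (Fin d)) := by
        intro hi'
        apply hne
        apply e.injective
        apply Subtype.ext
        exact G.eq_of_mem_parts (e q').2 (e q).2 hi' hi
      simp [this]
    · simp
  constructor
  · rintro ⟨Z, ⟨e, hZ⟩, v, hw⟩ g hg i hi j hj
    have hq : (e (e.symm ⟨g, hg⟩) : Finset (Fin d)) = g := by simp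
    rw [hw, hw]
    simp only [Matrix.mulVec, dotProduct, hZ]
    rw [key e v (e.symm ⟨g, hg⟩) i (by rwa [hq]), key e v (e.symm ⟨g, hg⟩) j (by rwa [hq])]
  · intro h
    let e := G.parts.equivFin.symm
    have hne : ∀ q, ((e q : Finset (Fin d))).Nonempty := fun q =>
      G.nonempty_of_mem_parts (e q).2
    refine ⟨fun i q => if i ∈ (e q : Finset (Fin d)) then 1 else 0, ⟨e, fun _ _ => rfl⟩,
      fun q => w (hne q).choose, fun i => ?_⟩
    obtain ⟨g, hg, hi⟩ := G.exists_mem (Finset.mem_univ i)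
    have hq : (e (e.symm ⟨g, hg⟩) : Finset (Fin d)) = g := by simp
    simp only [Matrix.mulVec, dotProduct]
    rw [key e _ (e.symm ⟨g, hg⟩) i (by rwa [hq])]
    refine h g hg i hi _ ?_
    have := (hne (e.symm ⟨g, hg⟩)).choose_spec
    exact (Finset.ext_iff.mp hq _).mp this

/-- The subspace `𝒰_G = {w : w = Z v, Z an assignment matrix of G}` of `ℝ^d`. -/
def partitionSubspace {d : ℕ} (G : Finpartition (Finset.univ : Finset (Fin d))) :
    Submodule ℝ (EuclideanSpace ℝ (Fin d)) where
  carrier := {w | ∃ Z, IsAssignmentMatrix G Z ∧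
    ∃ v : Fin G.parts.card → ℝ, ∀ i, w i = (Z.mulVec v) i}
  add_mem' := by
    intro a b ha hb
    rw [Set.mem_ofPred_eq, exists_assignment_iff] at *
    intro g hg i hi j hj
    simp [ha g hg i hi j hj, hb g hg i hi j hj]
  zero_mem' := by
    rw [Set.mem_ofPred_eq, exists_assignment_iff]
    simp
  smul_mem' := by
    intro r a ha
    rw [Set.mem_ofPred_eq, exists_assignment_iff] at *
    intro g hg i hi j hj
    simp [ha g hg i hi j hj]

/-- Partitions of the `d` features into exactly `Q` (nonempty) groups. -/
def partitionsInto (d Q : ℕ) : Set (Finpartition (Finset.univ : Finset (Fin d))) :=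
  {G | G.parts.card = Q}

/-- The collection `ℰ₁`. -/
def E1 (d Q : ℕ) : Set (Submodule ℝ (EuclideanSpace ℝ (Fin d))) :=
  {U | ∃ G ∈ partitionsInto d Q, U = partitionSubspace G}

/-- The collection `ℰ₂`. -/
def E2 (d Q : ℕ) : Set (Submodule ℝ (EuclideanSpace ℝ (Fin d))) :=
  {U | ∃ G₁ ∈ partitionsInto d Q, ∃ G₂ ∈ partitionsInto d Q,
    U = partitionSubspace G₁ ⊔ partitionSubspace G₂}

/-- The collection `ℰ₃`. -/
def E3 (d Q : ℕ) : Set (Submodule ℝ (EuclideanSpace ℝ (Fin d))) :=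
  {U | ∃ G₁ ∈ partitionsInto d Q, ∃ G₂ ∈ partitionsInto d Q, ∃ G₃ ∈ partitionsInto d Q,
    U = partitionSubspace G₁ ⊔ partitionSubspace G₂ ⊔ partitionSubspace G₃}

/-- `ℰ₁` is finite, so its cardinality and the maximal dimension below are genuine. -/
theorem E1_finite (d Q : ℕ) : (E1 d Q).Finite := by
  refine ((Set.toFinite (partitionsInto d Q)).image partitionSubspace).subset ?_
  rintro U ⟨G, hG, rfl⟩
  exact ⟨G, hG, rfl⟩

/-- `D`, the maximal dimension of a subspace in `ℰ₁`. -/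
def maxDim (d Q : ℕ) : ℕ :=
  sSup ((fun U : Submodule ℝ (EuclideanSpace ℝ (Fin d)) => Module.finrank ℝ U) '' E1 d Q)

/-- `N`, the number of subspaces in `ℰ₁`. -/
def numSubspaces (d Q : ℕ) : ℕ := (E1 d Q).ncard

/-- `δ_p = C₀ √(p D / n) + √((1 + p log N) / (c n))`. -/
def delta (C₀ c : ℝ) (d Q n p : ℕ) : ℝ :=
  C₀ * √((p * maxDim d Q : ℝ) / n) + √((1 + p * Real.log (numSubspaces d Q)) / (c * n))

/-- The matrix whose columns are the vectors of an orthonormal basis of `U`. -/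
def basisMatrix {d m : ℕ} {U : Submodule ℝ (EuclideanSpace ℝ (Fin d))}
    (b : OrthonormalBasis (Fin m) ℝ U) : Matrix (Fin d) (Fin m) ℝ :=
  Matrix.of fun i j => (b j : EuclideanSpace ℝ (Fin d)) i

/-! ### Random vectors -/

/-- The matrix with rows `x i`. -/
def designMatrix {n d : ℕ} (x : Fin n → EuclideanSpace ℝ (Fin d)) : Matrix (Fin n) (Fin d) ℝ :=
  Matrix.of fun i j => x i j

/-- The sub-gaussian norm `sup_{p ≥ 1} p^{-1/2} (E |Y|^p)^{1/p}` of a real random variable, with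
values in `[0, ∞]`. -/
def psi2Norm {Ω : Type*} [MeasurableSpace Ω] (Y : Ω → ℝ) (μ : Measure Ω) : ℝ≥0∞ :=
  ⨆ (p : ℝ) (_ : 1 ≤ p), ENNReal.ofReal p ^ (-(1 / 2) : ℝ) * eLpNorm Y (ENNReal.ofReal p) μ

/-- The sub-gaussian norm of a random vector: the supremum of the sub-gaussian norms of its
one-dimensional marginals in unit directions. The vector is sub-gaussian iff this is finite. -/
def vectorPsi2Norm {Ω : Type*} [MeasurableSpace Ω] {d : ℕ} (x : Ω → EuclideanSpace ℝ (Fin d))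
    (μ : Measure Ω) : ℝ≥0∞ :=
  ⨆ (θ : EuclideanSpace ℝ (Fin d)) (_ : ‖θ‖ = 1), psi2Norm (fun ω => inner ℝ (x ω) θ) μ

/-- Isotropy: `E[x xᵀ]` is the identity matrix. -/
def IsIsotropic {Ω : Type*} [MeasurableSpace Ω] {d : ℕ} (x : Ω → EuclideanSpace ℝ (Fin d))
    (μ : Measure Ω) : Prop :=
  ∀ j k : Fin d, Integrable (fun ω => x ω j * x ω k) μ ∧
    ∫ ω, x ω j * x ω k ∂μ = (1 : Matrix (Fin d) (Fin d) ℝ) j k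

end ClusteredDesign

end

open ClusteredDesign

universe u

noncomputable section

namespace ClusteredDesign

/-! ### Moments and exponential moments of squares of sub-gaussian variables -/

section Scalar

variable {Ω : Type*} [MeasurableSpace Ω] {μ : Measure Ω} {K : ℝ≥0}

/-! Everything follows from a uniform bound on `covarianceDefect`, the form of `n⁻¹ XᵀX - I`. For a
fixed unit `θ` its value is an average of independent centred variables `⟨x_i, θ⟩² - 1` whose moment
generating function is sub-gaussian near zero, so Bernstein (`measureReal_abs_sum_sq_sub_ge_le`)
bounds the probability of a deviation `max t t² / 2` by `2 exp(-a n t²)`, with `a = 1/(1152 K⁴)` and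
`K ≥ 1`.

A `1/4`-net of at most `9 ^ k` points extends this to all unit vectors of a `k`-dimensional
subspace, doubling the deviation (`abs_quad_le_of_net`). A union bound then covers at most `N ^ p`
sums of `p` subspaces, of dimension at most `p D`. With `t = δ_p + ε`, the three squares inside `t²`
pay for the net, for the number of subspaces and for the final probability (`union_bound_le_exp`).

On the good event `|‖Xθ‖²/n - ‖θ‖²| ≤ max t t² ‖θ‖²` on every subspace. The norm bound follows by a
square root, and the Gram bound by polarization. -/

theorem eLpNorm_le_of_psi2Norm_le {z : Ω → ℝ} (hK : psi2Norm z μ ≤ K) {p : ℝ} (hp : 1 ≤ p) :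
    eLpNorm z (ENNReal.ofReal p) μ ≤ ENNReal.ofReal (p ^ (1 / 2 : ℝ) * K) := by
  have hp0 : 0 < p := by linarith
  have h : ENNReal.ofReal p ^ (-(1 / 2) : ℝ) * eLpNorm z (ENNReal.ofReal p) μ ≤ K :=
    (le_iSup₂ (f := fun (p : ℝ) (_ : 1 ≤ p) =>
      ENNReal.ofReal p ^ (-(1 / 2) : ℝ) * eLpNorm z (ENNReal.ofReal p) μ) p hp).trans hK
  rw [ENNReal.ofReal_rpow_of_pos hp0, Real.rpow_neg hp0.le,
    ENNReal.ofReal_inv_of_pos (by positivity)] at h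
  rw [ENNReal.ofReal_mul (by positivity), ENNReal.ofReal_coe_nnreal]
  rwa [ENNReal.inv_mul_le_iff (by simp; positivity) ENNReal.ofReal_ne_top] at h

theorem memLp_of_psi2Norm_le {z : Ω → ℝ} (hz : AEStronglyMeasurable z μ)
    (hK : psi2Norm z μ ≤ K) {p : ℝ} (hp : 1 ≤ p) : MemLp z (ENNReal.ofReal p) μ :=
  ⟨hz, (eLpNorm_le_of_psi2Norm_le hK hp).trans_lt ENNReal.ofReal_lt_top⟩

theorem integrable_sq_pow_of_psi2Norm_le {z : Ω → ℝ} (hz : AEStronglyMeasurable z μ)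
    (hK : psi2Norm z μ ≤ K) {p : ℕ} (hp : 1 ≤ p) : Integrable (fun ω => (z ω ^ 2) ^ p) μ := by
  have hp' : (1 : ℝ) ≤ p := by exact_mod_cast hp
  have h := memLp_of_psi2Norm_le hz hK (p := (2 * p : ℕ)) (by push_cast; linarith)
  rw [ENNReal.ofReal_natCast] at h
  have := h.integrable_norm_pow (by omega)
  simpa [pow_mul] using this

theorem integral_sq_pow_le_of_psi2Norm_le {z : Ω → ℝ} (hz : AEStronglyMeasurable z μ)
    (hK : psi2Norm z μ ≤ K) {p : ℕ} (hp : 1 ≤ p) :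
    ∫ ω, (z ω ^ 2) ^ p ∂μ ≤ (2 * p * K ^ 2) ^ p := by
  have hp' : (1 : ℝ) ≤ p := by exact_mod_cast hp
  have h1 : (1 : ℝ) ≤ (2 * p : ℕ) := by push_cast; linarith
  have h0 : (0 : ℝ) < (2 * p : ℕ) := by linarith
  have hm := memLp_of_psi2Norm_le hz hK h1
  have hle := eLpNorm_le_of_psi2Norm_le hK h1
  rw [hm.eLpNorm_eq_integral_rpow_norm (ENNReal.ofReal_pos.2 h0).ne'
      ENNReal.ofReal_ne_top,
    ENNReal.ofReal_le_ofReal_iff (by positivity), ENNReal.toReal_ofReal h0.le] at hle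
  have hint : 0 ≤ ∫ ω, ‖z ω‖ ^ ((2 * p : ℕ) : ℝ) ∂μ := integral_nonneg fun _ => by positivity
  have := pow_le_pow_left₀ (by positivity) hle (2 * p)
  rw [← Real.rpow_natCast, ← Real.rpow_mul hint, inv_mul_cancel₀ h0.ne', Real.rpow_one] at this
  calc ∫ ω, (z ω ^ 2) ^ p ∂μ = ∫ ω, ‖z ω‖ ^ ((2 * p : ℕ) : ℝ) ∂μ := by
        simp only [Real.rpow_natCast, pow_mul, Real.norm_eq_abs, sq_abs]
    _ ≤ _ := this
    _ = (2 * p * K ^ 2) ^ p := by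
        rw [pow_mul, mul_pow _ (K : ℝ), ← Real.sqrt_eq_rpow, Real.sq_sqrt h0.le]
        push_cast
        ring

/-- Since `p ^ p / p! ≤ e ^ p ≤ 3 ^ p`, the factorial absorbs the growth of the moments and the
exponential series is dominated by a geometric one. -/
theorem abs_mul_pow_div_factorial_le {l K : ℝ} (p : ℕ) :
    |l| ^ p * (2 * p * K ^ 2) ^ p / (p.factorial : ℝ) ≤ (6 * K ^ 2 * |l|) ^ p := by
  have h : (p : ℝ) ^ p / (p.factorial : ℝ) ≤ 3 ^ p := by
    refine (Real.pow_div_factorial_le_exp _ (Nat.cast_nonneg p) p).trans ?_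
    rw [← Real.exp_one_pow]
    exact pow_le_pow_left₀ (Real.exp_pos 1).le (by linarith [Real.exp_one_lt_d9]) _
  calc |l| ^ p * (2 * p * K ^ 2) ^ p / (p.factorial : ℝ)
      = (2 * K ^ 2 * |l|) ^ p * ((p : ℝ) ^ p / (p.factorial : ℝ)) := by
        simp only [mul_pow]; ring
    _ ≤ (2 * K ^ 2 * |l|) ^ p * 3 ^ p := by gcongr
    _ = _ := by rw [← mul_pow]; ring

theorem integral_abs_pow_div_factorial_le {z : Ω → ℝ} (hz : AEStronglyMeasurable z μ)
    (hK : psi2Norm z μ ≤ K) (l : ℝ) {p : ℕ} (hp : 1 ≤ p) :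
    ∫ ω, |(l * z ω ^ 2) ^ p / (p.factorial : ℝ)| ∂μ ≤ (6 * K ^ 2 * |l|) ^ p := by
  calc ∫ ω, |(l * z ω ^ 2) ^ p / (p.factorial : ℝ)| ∂μ
      = |l| ^ p * (∫ ω, (z ω ^ 2) ^ p ∂μ) / (p.factorial : ℝ) := by
        rw [← integral_const_mul, ← integral_div]
        simp [abs_mul, mul_pow, abs_div, abs_pow]
    _ ≤ |l| ^ p * (2 * p * K ^ 2) ^ p / (p.factorial : ℝ) := by
        gcongr
        exact integral_sq_pow_le_of_psi2Norm_le hz hK hp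
    _ ≤ _ := abs_mul_pow_div_factorial_le p

variable [IsProbabilityMeasure μ]

theorem hasSum_integral_exp_mul_sq {z : Ω → ℝ} (hz : AEStronglyMeasurable z μ)
    (hK : psi2Norm z μ ≤ K) {l : ℝ} (hl : 6 * (K : ℝ) ^ 2 * |l| ≤ 1 / 2) :
    HasSum (fun p : ℕ => ∫ ω, (l * z ω ^ 2) ^ p / (p.factorial : ℝ) ∂μ)
      (∫ ω, Real.exp (l * z ω ^ 2) ∂μ) := by
  have hint (p : ℕ) : Integrable (fun ω => (l * z ω ^ 2) ^ p / (p.factorial : ℝ)) μ := by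
    rcases Nat.eq_zero_or_pos p with rfl | hp
    · simp
    · simp only [mul_pow]
      exact ((integrable_sq_pow_of_psi2Norm_le hz hK hp).const_mul _).div_const _
  have hsum : Summable fun p : ℕ => ∫ ω, ‖(l * z ω ^ 2) ^ p / (p.factorial : ℝ)‖ ∂μ := by
    refine Summable.of_nonneg_of_le (fun p => integral_nonneg fun _ => norm_nonneg _) (fun p => ?_)
      (summable_geometric_of_lt_one (by positivity) (hl.trans_lt (by norm_num)))
    rcases Nat.eq_zero_or_pos p with rfl | hp
    · simp
    · exact integral_abs_pow_div_factorial_le hz hK l hp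
  have := hasSum_integral_of_summable_integral_norm hint hsum
  simpa only [Real.exp_eq_exp_ℝ, NormedSpace.exp_eq_tsum_div] using this

theorem integrable_exp_mul_sq {z : Ω → ℝ} (hz : AEStronglyMeasurable z μ)
    (hK : psi2Norm z μ ≤ K) {l : ℝ} (hl : 6 * (K : ℝ) ^ 2 * |l| ≤ 1 / 2) :
    Integrable (fun ω => Real.exp (l * z ω ^ 2)) μ := by
  -- With `|l|` all terms are nonnegative, so the integral is at least its zeroth term `1`. A
  -- non-integrable function would have integral `0` by convention.
  have h := hasSum_integral_exp_mul_sq hz hK (l := |l|) (by rwa [abs_abs])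
  have h1 : (1 : ℝ) ≤ ∫ ω, Real.exp (|l| * z ω ^ 2) ∂μ := by
    have := le_hasSum h 0 fun p _ => integral_nonneg fun ω => by positivity
    simpa using this
  have hi : Integrable (fun ω => Real.exp (|l| * z ω ^ 2)) μ := by
    by_contra hn
    rw [integral_undef hn] at h1
    linarith
  refine hi.mono (by fun_prop) (Filter.Eventually.of_forall fun ω => ?_)
  simp only [Real.norm_eq_abs, Real.abs_exp, Real.exp_le_exp]
  gcongr
  exact le_abs_self l

/-- The square of a sub-gaussian variable of second moment one has a locally sub-gaussian
moment generating function. -/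
theorem mgf_sq_le {z : Ω → ℝ} (hz : AEStronglyMeasurable z μ)
    (hK : psi2Norm z μ ≤ K) (h2 : ∫ ω, z ω ^ 2 ∂μ = 1) {l : ℝ}
    (hl : 6 * (K : ℝ) ^ 2 * |l| ≤ 1 / 2) :
    mgf (fun ω => z ω ^ 2) μ l ≤ Real.exp (l + 72 * K ^ 4 * l ^ 2) := by
  have h := hasSum_integral_exp_mul_sq hz hK hl
  set a : ℝ := 6 * (K : ℝ) ^ 2 * |l| with ha
  have ha0 : 0 ≤ a := by positivity
  have hg : HasSum (fun p : ℕ => a ^ (p + 2)) (a ^ 2 * (1 - a)⁻¹) := by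
    have := (hasSum_geometric_of_lt_one ha0 (hl.trans_lt (by norm_num))).mul_left (a ^ 2)
    simpa only [← pow_add, add_comm 2] using this
  -- The terms `p = 0, 1` sum to `1 + l` by `h2`. The rest is at most `a² / (1 - a) ≤ 2 a² = 72 K⁴
  -- l²`, and `1 + y ≤ exp y` concludes.
  have htail := (hasSum_nat_add_iff' 2).2 h
  have hle := hasSum_le (fun p => ?_) htail hg
  · simp only [Finset.sum_range_succ, Finset.sum_range_zero] at hle
    have hinv : (1 - a)⁻¹ ≤ 2 := by
      rw [inv_le_comm₀ (by linarith) (by norm_num)]; linarith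
    have hs : a ^ 2 * (1 - a)⁻¹ ≤ 72 * K ^ 4 * l ^ 2 := by
      calc a ^ 2 * (1 - a)⁻¹ ≤ a ^ 2 * 2 := by gcongr
        _ = _ := by rw [ha, mul_pow, sq_abs]; ring
    simp [integral_const_mul, h2] at hle
    have := Real.add_one_le_exp (l + 72 * (K : ℝ) ^ 4 * l ^ 2)
    unfold mgf
    linarith
  · exact (le_abs_self _).trans (abs_integral_le_integral_abs.trans
      (integral_abs_pow_div_factorial_le hz hK l (by omega)))

/-- Bernstein inequality for the empirical second moment of independent sub-gaussian variables
of second moment one. -/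
theorem measureReal_abs_sum_sq_sub_ge_le {n : ℕ} {z : Fin n → Ω → ℝ}
    (hz : ∀ i, Measurable (z i)) (hind : iIndepFun z μ) (hK1 : 1 ≤ K)
    (hK : ∀ i, psi2Norm (z i) μ ≤ K) (h2 : ∀ i, ∫ ω, z i ω ^ 2 ∂μ = 1) {t : ℝ} (ht : 0 ≤ t) :
    μ.real {ω | n * (max t (t ^ 2) / 2) ≤ |∑ i, z i ω ^ 2 - n|} ≤
      2 * Real.exp (-(n * t ^ 2 / (1152 * K ^ 4))) := by
  have hK1' : (1 : ℝ) ≤ K := by exact_mod_cast hK1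
  set s := max t (t ^ 2) / 2 with hs
  set a : ℝ := 1 / (288 * K ^ 4) with ha
  have ha0 : 0 < a := by positivity
  -- As `min t 1 * max t t² = t²`, this gives `l s = a t² / 2` in both Bernstein regimes, while the
  -- quadratic term costs at most `a t² / 4`. The remaining `a t² / 4` is `t² / (1152 K⁴)`.
  set l := a * min t 1 with hl
  have hm0 : 0 ≤ min t 1 := le_min ht zero_le_one
  have hl0 : 0 ≤ l := by positivity
  have hls : l * s = a / 2 * t ^ 2 := by
    rw [hl, hs]
    rcases le_total t 1 with h | h
    · rw [min_eq_left h, max_eq_left (by nlinarith)]; ring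
    · rw [min_eq_right h, max_eq_right (by nlinarith)]; ring
  have hl2 : 72 * (K : ℝ) ^ 4 * l ^ 2 ≤ a / 4 * t ^ 2 := by
    have : (min t 1) ^ 2 ≤ t ^ 2 := pow_le_pow_left₀ hm0 (min_le_left _ _) 2
    calc 72 * (K : ℝ) ^ 4 * l ^ 2 = a / 4 * (min t 1) ^ 2 := by rw [hl, ha]; field_simp; ring
      _ ≤ _ := by gcongr
  have hlK : 6 * (K : ℝ) ^ 2 * l ≤ 1 / 2 := by
    calc 6 * (K : ℝ) ^ 2 * l ≤ 6 * (K : ℝ) ^ 2 * (a * 1) := by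
          rw [hl]; gcongr; exact min_le_right _ _
      _ = 1 / (48 * (K : ℝ) ^ 2) := by rw [ha]; field_simp; norm_num
      _ ≤ 1 / 2 := by
          apply one_div_le_one_div_of_le (by norm_num)
          nlinarith
  have hind2 : iIndepFun (fun i ω => z i ω ^ 2) μ :=
    hind.comp (fun _ y => y ^ 2) fun _ => by fun_prop
  have hz2 (i) : Measurable fun ω => z i ω ^ 2 := (hz i).pow_const 2
  have key (l' : ℝ) (hl' : |l'| = l) :
      Integrable (fun ω => Real.exp (l' * (∑ i, fun ω => z i ω ^ 2) ω)) μ ∧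
      mgf (∑ i, fun ω => z i ω ^ 2) μ l' ≤ Real.exp (n * (l' + a / 4 * t ^ 2)) := by
    have hb : 6 * (K : ℝ) ^ 2 * |l'| ≤ 1 / 2 := by rwa [hl']
    refine ⟨hind2.integrable_exp_mul_sum hz2 fun i _ =>
      integrable_exp_mul_sq (hz i).aestronglyMeasurable (hK i) hb, ?_⟩
    rw [hind2.mgf_sum hz2, Real.exp_nat_mul]
    refine (Finset.prod_le_prod (fun i _ => mgf_nonneg)
      (g := fun _ => Real.exp (l' + a / 4 * t ^ 2)) fun i _ => ?_).trans_eq (by simp)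
    refine (mgf_sq_le (hz i).aestronglyMeasurable (hK i) (h2 i) hb).trans ?_
    rw [← sq_abs l', hl']
    gcongr
  obtain ⟨hi1, hm1⟩ := key l (abs_of_nonneg hl0)
  obtain ⟨hi2, hm2⟩ := key (-l) (by rw [abs_neg, abs_of_nonneg hl0])
  have h1 := measure_ge_le_exp_mul_mgf (n * (1 + s)) hl0 hi1
  have h3 := measure_le_le_exp_mul_mgf (n * (1 - s)) (neg_nonpos.2 hl0) hi2
  have e1 : μ.real {ω | n * (1 + s) ≤ (∑ i, fun ω => z i ω ^ 2) ω} ≤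
      Real.exp (-(n * t ^ 2 / (1152 * K ^ 4))) := by
    refine h1.trans ((mul_le_mul_of_nonneg_left hm1 (Real.exp_pos _).le).trans_eq ?_)
    rw [← Real.exp_add]
    congr 1
    have : -l * (n * (1 + s)) + n * (l + a / 4 * t ^ 2) = -(n * (l * s)) + n * (a / 4 * t ^ 2) := by
      ring
    rw [this, hls, ha]; field_simp; ring
  have e2 : μ.real {ω | (∑ i, fun ω => z i ω ^ 2) ω ≤ n * (1 - s)} ≤
      Real.exp (-(n * t ^ 2 / (1152 * K ^ 4))) := by
    refine h3.trans ((mul_le_mul_of_nonneg_left hm2 (Real.exp_pos _).le).trans_eq ?_)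
    rw [← Real.exp_add]
    congr 1
    have : - -l * (n * (1 - s)) + n * (-l + a / 4 * t ^ 2)
        = -(n * (l * s)) + n * (a / 4 * t ^ 2) := by ring
    rw [this, hls, ha]; field_simp; ring
  calc _ ≤ μ.real ({ω | n * (1 + s) ≤ (∑ i, fun ω => z i ω ^ 2) ω} ∪
        {ω | (∑ i, fun ω => z i ω ^ 2) ω ≤ n * (1 - s)}) := by
        refine measureReal_mono fun ω hω => ?_
        simp only [Set.mem_ofPred_eq, Set.mem_union, Finset.sum_apply] at hω ⊢
        rcases le_abs.1 hω with h | h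
        · left; linarith
        · right; linarith
    _ ≤ _ := measureReal_union_le _ _
    _ ≤ _ := by linarith

end Scalar

/-! ### Nets of unit spheres and symmetric bilinear forms -/

section Net

open Metric Module

variable {E : Type*} [NormedAddCommGroup E] [NormedSpace ℝ E] [FiniteDimensional ℝ E]

/-- Volume comparison: the balls of radius `1/8` about the points are disjoint and lie in the ball
of radius `9/8`. -/
theorem card_le_of_quarter_separated (s : Finset E) (hs : ∀ c ∈ s, ‖c‖ = 1)
    (h : ∀ c ∈ s, ∀ d ∈ s, c ≠ d → 1 / 4 ≤ ‖c - d‖) : s.card ≤ 9 ^ finrank ℝ E := by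
  borelize E
  let ν : Measure E := Measure.addHaar
  have D : Set.Pairwise (s : Set E) (Function.onFun Disjoint fun c => ball (c : E) (1 / 8)) := by
    intro c hc d hd hcd
    apply ball_disjoint_ball
    rw [dist_eq_norm]
    linarith [h c hc d hd hcd]
  have hsub : (⋃ c ∈ s, ball (c : E) (1 / 8)) ⊆ ball (0 : E) (9 / 8) := by
    refine Set.iUnion₂_subset fun x hx => ball_subset_ball' ?_
    rw [dist_zero_right, hs x hx]
    norm_num
  have hvol : (s.card : ℝ≥0∞) * ENNReal.ofReal ((1 / 8) ^ finrank ℝ E) * ν (ball 0 1) ≤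
      ENNReal.ofReal ((9 / 8) ^ finrank ℝ E) * ν (ball 0 1) :=
    calc _ = ν (⋃ c ∈ s, ball (c : E) (1 / 8)) := by
          rw [measure_biUnion_finset D fun c _ => measurableSet_ball]
          simp only [ν.addHaar_ball_of_pos _ (show (0 : ℝ) < 1 / 8 by norm_num),
            Finset.sum_const, nsmul_eq_mul, mul_assoc]
      _ ≤ ν (ball (0 : E) (9 / 8)) := measure_mono hsub
      _ = _ := by rw [ν.addHaar_ball_of_pos _ (by norm_num)]
  have hcard : (s.card : ℝ≥0∞) * ENNReal.ofReal ((1 / 8) ^ finrank ℝ E) ≤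
      ENNReal.ofReal ((9 / 8) ^ finrank ℝ E) :=
    (ENNReal.mul_le_mul_iff_left (measure_ball_pos _ _ zero_lt_one).ne'
      measure_ball_lt_top.ne).1 hvol
  have : (s.card : ℝ) ≤ (9 : ℝ) ^ finrank ℝ E := by
    have := ENNReal.toReal_le_of_le_ofReal (by positivity) hcard
    simpa [div_eq_mul_inv, mul_pow] using this
  exact_mod_cast this

variable (E) in
/-- The unit sphere of a `k`-dimensional space has a `1/4`-net with at most `9 ^ k` points. -/
theorem exists_sphere_net : ∃ s : Finset E, s.card ≤ 9 ^ finrank ℝ E ∧ (∀ y ∈ s, ‖y‖ = 1) ∧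
    ∀ x : E, ‖x‖ = 1 → ∃ y ∈ s, ‖x - y‖ ≤ 1 / 4 := by
  classical
  let P : Finset E → Prop := fun s => (∀ y ∈ s, ‖y‖ = 1) ∧
    ∀ c ∈ s, ∀ d ∈ s, c ≠ d → 1 / 4 ≤ ‖c - d‖
  have hbdd : BddAbove {m : ℕ | ∃ s, P s ∧ s.card = m} := by
    refine ⟨9 ^ finrank ℝ E, ?_⟩
    rintro _ ⟨s, hs, rfl⟩
    exact card_le_of_quarter_separated s hs.1 hs.2
  -- A separated set of maximal cardinality is a net: a point far from it could be added.
  obtain ⟨s, hs, hcard⟩ := Nat.sSup_mem (s := {m : ℕ | ∃ s, P s ∧ s.card = m})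
    ⟨0, ∅, by simp [P], rfl⟩ hbdd
  refine ⟨s, card_le_of_quarter_separated s hs.1 hs.2, hs.1, fun x hx => ?_⟩
  by_contra! hfar
  have hxs : x ∉ s := fun hxs => by
    have := hfar x hxs
    simp at this
    linarith
  have hins : P (insert x s) := by
    refine ⟨by simpa [hx] using hs.1, fun c hc d hd hcd => ?_⟩
    rcases Finset.mem_insert.1 hc with rfl | hc' <;> rcases Finset.mem_insert.1 hd with rfl | hd'
    · exact absurd rfl hcd
    · exact (hfar d hd').le
    · rw [norm_sub_rev]; exact (hfar c hc').le
    · exact hs.2 c hc' d hd' hcd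
  have := le_csSup hbdd ⟨_, hins, rfl⟩
  rw [← hcard, Finset.card_insert_of_notMem hxs] at this
  omega

end Net

section BilinForm

variable {E : Type*} [NormedAddCommGroup E] [InnerProductSpace ℝ E]

/-- Polarization: a symmetric bilinear form is bounded by its quadratic form. -/
theorem abs_bilin_le_of_abs_quad_le {B : LinearMap.BilinForm ℝ E} (hB : B.IsSymm) {M : ℝ}
    (hM : ∀ x, |B x x| ≤ M * ‖x‖ ^ 2) (u v : E) : |B u v| ≤ M * ‖u‖ * ‖v‖ := by
  rcases eq_or_ne u 0 with rfl | hu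
  · simp
  rcases eq_or_ne v 0 with rfl | hv
  · simp
  have hu' := norm_pos_iff.2 hu
  have hv' := norm_pos_iff.2 hv
  -- Rescaling to equal norms makes the parallelogram law produce the product `‖u‖ * ‖v‖` instead of
  -- a mean of squares.
  set p := ‖v‖ • u
  set q := ‖u‖ • v
  have hp : ‖p‖ = ‖u‖ * ‖v‖ := by simp [p, norm_smul, mul_comm]
  have hq : ‖q‖ = ‖u‖ * ‖v‖ := by simp [q, norm_smul]
  have hpq : B p q = ‖u‖ * ‖v‖ * B u v := by simp [p, q]; ring
  have hpol : B (p + q) (p + q) - B (p - q) (p - q) = 4 * B p q := by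
    simp only [map_add, map_sub, LinearMap.add_apply, LinearMap.sub_apply]
    rw [show B q p = B p q from hB.eq q p]
    ring
  have h1 := abs_le.1 (hM (p + q))
  have h2 := abs_le.1 (hM (p - q))
  have hpar := parallelogram_law_with_norm ℝ p q
  have hsum : M * ‖p + q‖ ^ 2 + M * ‖p - q‖ ^ 2 = 4 * (M * (‖u‖ * ‖v‖) ^ 2) := by
    calc _ = M * (‖p + q‖ ^ 2 + ‖p - q‖ ^ 2) := by ring
      _ = _ := by rw [hpar, hp, hq]; ring
  have h3 : |‖u‖ * ‖v‖ * B u v| ≤ M * (‖u‖ * ‖v‖) ^ 2 := by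
    rw [← hpq, abs_le]
    constructor <;> linarith [h1.1, h1.2, h2.1, h2.2]
  rw [abs_mul, abs_of_pos (by positivity)] at h3
  have : ‖u‖ * ‖v‖ * |B u v| ≤ ‖u‖ * ‖v‖ * (M * ‖u‖ * ‖v‖) := by linarith
  exact le_of_mul_le_mul_left this (by positivity)

/-- A symmetric bilinear form is controlled on the unit sphere by its values on a `1/4`-net. -/
theorem abs_quad_le_of_net [FiniteDimensional ℝ E] {B : LinearMap.BilinForm ℝ E} (hB : B.IsSymm)
    {s : Finset E} (hs1 : ∀ y ∈ s, ‖y‖ = 1) (hs : ∀ x : E, ‖x‖ = 1 → ∃ y ∈ s, ‖x - y‖ ≤ 1 / 4)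
    {M : ℝ} (hM : ∀ y ∈ s, |B y y| ≤ M / 2) (x : E) : |B x x| ≤ M * ‖x‖ ^ 2 := by
  rcases eq_or_ne x 0 with rfl | hx
  · simp
  have hxn := norm_pos_iff.2 hx
  have hcont : Continuous fun y => |B y y| := by
    have h : Continuous fun y : E => LinearMap.toContinuousLinearMap (B y) :=
      ((LinearMap.toContinuousLinearMap : (E →ₗ[ℝ] ℝ) ≃ₗ[ℝ] _).toLinearMap ∘ₗ
        B).continuous_of_finiteDimensional
    exact (h.clm_apply continuous_id).abs
  have hscale (w : E) (hw : w ≠ 0) : |B w w| = |B (‖w‖⁻¹ • w) (‖w‖⁻¹ • w)| * ‖w‖ ^ 2 := by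
    have := norm_pos_iff.2 hw
    simp only [map_smul, LinearMap.smul_apply, smul_eq_mul, abs_mul, abs_inv, abs_norm]
    field_simp
  have hunit (w : E) (hw : w ≠ 0) : ‖‖w‖⁻¹ • w‖ = 1 := by
    simp [norm_smul, hw]
  have : ProperSpace E := FiniteDimensional.proper ℝ E
  obtain ⟨x₀, hx₀, hmax⟩ := (isCompact_sphere (0 : E) 1).exists_isMaxOn
    ⟨‖x‖⁻¹ • x, by simpa using hunit x hx⟩ hcont.continuousOn
  have hmax' (w : E) (hw : ‖w‖ = 1) : |B w w| ≤ |B x₀ x₀| := hmax (by simpa using hw)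
  have hquad (w : E) : |B w w| ≤ |B x₀ x₀| * ‖w‖ ^ 2 := by
    rcases eq_or_ne w 0 with rfl | hw
    · simp
    · rw [hscale w hw]
      exact mul_le_mul_of_nonneg_right (hmax' _ (hunit w hw)) (by positivity)
  have hx₀1 : ‖x₀‖ = 1 := by simpa using hx₀
  obtain ⟨y, hy, hxy⟩ := hs x₀ hx₀1
  -- By symmetry the error is a single value of `B`, at most `1/4 * 2` times the maximum `|B x₀
  -- x₀|`, and this half is absorbed on the left.
  have hdiff : B x₀ x₀ = B y y + B (x₀ - y) (x₀ + y) := by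
    simp only [map_add, map_sub, LinearMap.sub_apply]
    rw [show B y x₀ = B x₀ y from hB.eq y x₀]
    ring
  have hsum : ‖x₀ + y‖ ≤ 2 := (norm_add_le _ _).trans (by rw [hx₀1, hs1 y hy]; norm_num)
  have hb : |B (x₀ - y) (x₀ + y)| ≤ |B x₀ x₀| / 2 := by
    refine (abs_bilin_le_of_abs_quad_le hB hquad _ _).trans ?_
    calc |B x₀ x₀| * ‖x₀ - y‖ * ‖x₀ + y‖ ≤ |B x₀ x₀| * (1 / 4) * 2 := by gcongr
      _ = _ := by ring
  have hfin : |B x₀ x₀| ≤ M := by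
    have h1 := abs_add_le (B y y) (B (x₀ - y) (x₀ + y))
    rw [← hdiff] at h1
    linarith [hM y hy]
  exact (hquad x).trans (by gcongr)

theorem isSymm_restrict {B : LinearMap.BilinForm ℝ E} (hB : B.IsSymm) (W : Submodule ℝ E) :
    (B.restrict W).IsSymm := by
  rw [LinearMap.BilinForm.isSymm_def] at hB ⊢
  exact fun u v => hB u v

theorem abs_quad_le_of_submodule_net {B : LinearMap.BilinForm ℝ E} (hB : B.IsSymm)
    {W : Submodule ℝ E} [FiniteDimensional ℝ W] {s : Finset W} (hs1 : ∀ y ∈ s, ‖y‖ = 1)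
    (hs : ∀ x : W, ‖x‖ = 1 → ∃ y ∈ s, ‖x - y‖ ≤ 1 / 4)
    {M : ℝ} (hM : ∀ y ∈ s, |B y y| ≤ M / 2) {x : E} (hx : x ∈ W) : |B x x| ≤ M * ‖x‖ ^ 2 :=
  abs_quad_le_of_net (isSymm_restrict hB W) hs1 hs hM ⟨x, hx⟩

end BilinForm

/-! ### The empirical covariance form -/

section Design

variable {n d : ℕ}

/-- The bilinear form of `n⁻¹ XᵀX - I`, where `X` has rows `x i`. -/
def covarianceDefect (x : Fin n → EuclideanSpace ℝ (Fin d)) :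
    LinearMap.BilinForm ℝ (EuclideanSpace ℝ (Fin d)) :=
  (1 / n : ℝ) • ∑ i, LinearMap.BilinForm.linMulLin (innerₗ _ (x i)) (innerₗ _ (x i)) - innerₗ _

theorem covarianceDefect_apply (x : Fin n → EuclideanSpace ℝ (Fin d))
    (u v : EuclideanSpace ℝ (Fin d)) : covarianceDefect x u v =
      1 / n * ∑ i, inner ℝ (x i) u * inner ℝ (x i) v - inner ℝ u v := by
  simp [covarianceDefect, LinearMap.sum_apply]

theorem covarianceDefect_isSymm (x : Fin n → EuclideanSpace ℝ (Fin d)) :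
    (covarianceDefect x).IsSymm := by
  rw [LinearMap.BilinForm.isSymm_def]
  intro u v
  rw [covarianceDefect_apply, covarianceDefect_apply, real_inner_comm]
  simp only [mul_comm]

theorem basisMatrix_mulVec {m : ℕ} {U : Submodule ℝ (EuclideanSpace ℝ (Fin d))}
    (b : OrthonormalBasis (Fin m) ℝ U) (v : EuclideanSpace ℝ (Fin m)) :
    (basisMatrix b).mulVec v.ofLp = (b.repr.symm v : EuclideanSpace ℝ (Fin d)).ofLp := by
  ext i
  rw [← b.sum_repr_symm]
  simp [basisMatrix, Matrix.mulVec, dotProduct, mul_comm]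

theorem designMatrix_mul_basisMatrix_mulVec {m : ℕ} (x : Fin n → EuclideanSpace ℝ (Fin d))
    {U : Submodule ℝ (EuclideanSpace ℝ (Fin d))}
    (b : OrthonormalBasis (Fin m) ℝ U) (v : EuclideanSpace ℝ (Fin m)) :
    (designMatrix x * basisMatrix b).mulVec v.ofLp =
      fun i => inner ℝ (x i) (b.repr.symm v : EuclideanSpace ℝ (Fin d)) := by
  ext i
  rw [← Matrix.mulVec_mulVec, basisMatrix_mulVec]
  simp [designMatrix, Matrix.mulVec, dotProduct, PiLp.inner_apply, mul_comm]

theorem l2_opNorm_le_of_mulVec_le {m k : ℕ} (A : Matrix (Fin k) (Fin m) ℝ) {M : ℝ} (hM : 0 ≤ M)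
    (h : ∀ v : EuclideanSpace ℝ (Fin m), ‖WithLp.toLp 2 (A.mulVec v.ofLp)‖ ≤ M * ‖v‖) :
    ‖A‖ ≤ M := by
  rw [Matrix.l2_opNorm_def]
  refine ContinuousLinearMap.opNorm_le_bound _ hM fun v => ?_
  simpa [Matrix.toLpLin_apply] using h v

theorem norm_designMatrix_mul_basisMatrix_le {m : ℕ} (hn : 1 ≤ n)
    (x : Fin n → EuclideanSpace ℝ (Fin d)) {U : Submodule ℝ (EuclideanSpace ℝ (Fin d))}
    (b : OrthonormalBasis (Fin m) ℝ U) {t : ℝ} (ht : 0 ≤ t)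
    (h : ∀ θ ∈ U, |covarianceDefect x θ θ| ≤ max t (t ^ 2) * ‖θ‖ ^ 2) :
    1 / √(n : ℝ) * ‖designMatrix x * basisMatrix b‖ ≤ 1 + t := by
  have hn' : (0 : ℝ) < n := by exact_mod_cast hn
  rw [one_div_mul_eq_div, div_le_iff₀ (by positivity)]
  refine l2_opNorm_le_of_mulVec_le _ (by positivity) fun v => ?_
  rw [designMatrix_mul_basisMatrix_mulVec]
  set θ : EuclideanSpace ℝ (Fin d) := ((b.repr.symm v : U) : EuclideanSpace ℝ (Fin d)) with hθ
  have hnorm : ‖θ‖ = ‖v‖ := by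
    rw [hθ, ← Submodule.coe_norm, LinearIsometryEquiv.norm_map]
  have hθU := (abs_le.1 (h θ (b.repr.symm v).2)).2
  rw [covarianceDefect_apply, real_inner_self_eq_norm_sq, one_div_mul_eq_div, sub_le_iff_le_add,
    div_le_iff₀ hn'] at hθU
  refine abs_le_of_sq_le_sq' ?_ (by positivity) |>.2
  rw [EuclideanSpace.norm_sq_eq]
  have hs : max t (t ^ 2) + 1 ≤ (1 + t) ^ 2 := by
    have : max t (t ^ 2) ≤ 2 * t + t ^ 2 := max_le (by nlinarith) (by nlinarith)
    linarith
  calc _ = ∑ i, inner ℝ (x i) θ * inner ℝ (x i) θ := by simp [sq]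
    _ ≤ (max t (t ^ 2) * ‖θ‖ ^ 2 + ‖θ‖ ^ 2) * n := hθU
    _ = (max t (t ^ 2) + 1) * (‖v‖ ^ 2 * n) := by rw [hnorm]; ring
    _ ≤ (1 + t) ^ 2 * (‖v‖ ^ 2 * n) := by gcongr
    _ = _ := by rw [mul_pow, mul_pow, Real.sq_sqrt hn'.le]; ring

/-- In the basis `b` the matrix is that of minus the restricted `covarianceDefect`, so polarization
bounds its operator norm by the quadratic form. -/
theorem norm_one_sub_gram_le {m : ℕ}
    (x : Fin n → EuclideanSpace ℝ (Fin d)) {U : Submodule ℝ (EuclideanSpace ℝ (Fin d))}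
    (b : OrthonormalBasis (Fin m) ℝ U) {M : ℝ} (hM : 0 ≤ M)
    (h : ∀ θ ∈ U, |covarianceDefect x θ θ| ≤ M * ‖θ‖ ^ 2) :
    ‖(1 : Matrix (Fin m) (Fin m) ℝ) - (1 / (n : ℝ)) •
      ((basisMatrix b).transpose * (designMatrix x).transpose *
        designMatrix x * basisMatrix b)‖ ≤ M := by
  set A := designMatrix x * basisMatrix b with hA
  have hgram : (basisMatrix b).transpose * (designMatrix x).transpose *
      designMatrix x * basisMatrix b = A.transpose * A := by
    rw [hA, Matrix.transpose_mul, Matrix.mul_assoc _ (designMatrix x)]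
  rw [hgram]
  set S := (1 : Matrix (Fin m) (Fin m) ℝ) - (1 / (n : ℝ)) • (A.transpose * A) with hS
  have hbil (w v : EuclideanSpace ℝ (Fin m)) :
      inner ℝ w (WithLp.toLp 2 (S.mulVec v.ofLp)) =
        -covarianceDefect x (b.repr.symm w) (b.repr.symm v) := by
    rw [covarianceDefect_apply, ← Submodule.coe_inner, LinearIsometryEquiv.inner_map_map,
      EuclideanSpace.inner_eq_star_dotProduct, EuclideanSpace.inner_eq_star_dotProduct w v, hS]
    simp only [star_trivial]
    rw [Matrix.sub_mulVec, Matrix.one_mulVec, Matrix.smul_mulVec, ← Matrix.mulVec_mulVec,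
      sub_dotProduct, smul_dotProduct, Matrix.mulVec_transpose, ← Matrix.dotProduct_mulVec, hA,
      designMatrix_mul_basisMatrix_mulVec, designMatrix_mul_basisMatrix_mulVec]
    simp only [dotProduct, smul_eq_mul, mul_comm]
    ring
  have hpol := abs_bilin_le_of_abs_quad_le (isSymm_restrict (covarianceDefect_isSymm x) U)
    (M := M) fun u => h u u.2
  refine l2_opNorm_le_of_mulVec_le _ hM fun v => ?_
  set w := WithLp.toLp 2 (S.mulVec v.ofLp) with hw
  -- The form is tested against the image `w = S v` itself.
  have h1 : ‖w‖ * ‖w‖ ≤ M * ‖v‖ * ‖w‖ := by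
    rw [← real_inner_self_eq_norm_mul_norm, hbil w v]
    refine (neg_le_abs _).trans ((hpol (b.repr.symm w) (b.repr.symm v)).trans_eq ?_)
    simp only [LinearIsometryEquiv.norm_map]
    ring
  rcases (norm_nonneg w).eq_or_lt with h0 | h0
  · rw [← h0]; positivity
  · exact le_of_mul_le_mul_right h1 h0

end Design

/-! ### Uniform deviation over finitely many subspaces -/

section Deviation

variable {n d : ℕ} {Ω : Type*} [MeasurableSpace Ω] {μ : Measure Ω}

theorem integral_inner_sq_of_isIsotropic {x : Ω → EuclideanSpace ℝ (Fin d)}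
    (hx : IsIsotropic x μ) (θ : EuclideanSpace ℝ (Fin d)) :
    ∫ ω, inner ℝ (x ω) θ ^ 2 ∂μ = ‖θ‖ ^ 2 := by
  have hexp (ω : Ω) : inner ℝ (x ω) θ ^ 2 = ∑ j, ∑ k, θ j * θ k * (x ω j * x ω k) := by
    rw [sq, PiLp.inner_apply, Finset.sum_mul_sum]
    refine Finset.sum_congr rfl fun j _ => Finset.sum_congr rfl fun k _ => ?_
    simp
    ring
  simp only [hexp]
  rw [integral_finsetSum _ fun j _ => integrable_finsetSum _ fun k _ => (hx j k).1.const_mul _]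
  rw [EuclideanSpace.norm_sq_eq]
  refine Finset.sum_congr rfl fun j _ => ?_
  rw [integral_finsetSum _ fun k _ => (hx j k).1.const_mul _]
  simp [integral_const_mul, (hx j _).2, Matrix.one_apply, sq]

variable [IsProbabilityMeasure μ] {K : ℝ≥0} {x : Fin n → Ω → EuclideanSpace ℝ (Fin d)}

theorem measureReal_covarianceDefect_gt_le (hn : 1 ≤ n) (hK1 : 1 ≤ K)
    (hx : ∀ i, Measurable (x i)) (hind : iIndepFun x μ) (hiso : ∀ i, IsIsotropic (x i) μ)
    (hK : ∀ i, vectorPsi2Norm (x i) μ ≤ K) {t : ℝ} (ht : 0 ≤ t)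
    {θ : EuclideanSpace ℝ (Fin d)} (hθ : ‖θ‖ = 1) :
    μ.real {ω | max t (t ^ 2) / 2 < |covarianceDefect (fun i => x i ω) θ θ|} ≤
      2 * Real.exp (-(n * t ^ 2 / (1152 * K ^ 4))) := by
  have hn' : (0 : ℝ) < n := by exact_mod_cast hn
  have hmeas : Measurable fun v : EuclideanSpace ℝ (Fin d) => inner ℝ v θ := by fun_prop
  refine le_trans (measureReal_mono fun ω hω => ?_) (measureReal_abs_sum_sq_sub_ge_le
    (z := fun i ω => inner ℝ (x i ω) θ) (fun i => hmeas.comp (hx i))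
    (hind.comp (fun _ v => inner ℝ v θ) fun _ => hmeas) hK1 (fun i => ?_) (fun i => ?_) ht)
  · simp only [Set.mem_ofPred_eq] at hω ⊢
    rw [covarianceDefect_apply, real_inner_self_eq_norm_sq, hθ] at hω
    have heq : ∑ i, inner ℝ (x i ω) θ ^ 2 - (n : ℝ) =
        n * (1 / n * ∑ i, inner ℝ (x i ω) θ * inner ℝ (x i ω) θ - 1 ^ 2) := by
      field_simp
    rw [heq, abs_mul, abs_of_pos hn']
    gcongr
  · exact (le_iSup₂ (f := fun (θ : EuclideanSpace ℝ (Fin d)) (_ : ‖θ‖ = 1) =>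
      psi2Norm (fun ω => inner ℝ (x i ω) θ) μ) θ hθ).trans (hK i)
  · rw [integral_inner_sq_of_isIsotropic (hiso i), hθ, one_pow]

/-- If every net point deviates by at most half the threshold, no vector of `W` exceeds it. Only
monotonicity and subadditivity of `μ` are used, so the uncountable union over `θ` need not be shown
measurable. -/
theorem measureReal_exists_mem_gt_le (hn : 1 ≤ n) (hK1 : 1 ≤ K)
    (hx : ∀ i, Measurable (x i)) (hind : iIndepFun x μ) (hiso : ∀ i, IsIsotropic (x i) μ)
    (hK : ∀ i, vectorPsi2Norm (x i) μ ≤ K) {t : ℝ} (ht : 0 ≤ t)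
    (W : Submodule ℝ (EuclideanSpace ℝ (Fin d))) {k : ℕ} (hk : Module.finrank ℝ W ≤ k) :
    μ.real {ω | ∃ θ ∈ W,
        max t (t ^ 2) * ‖θ‖ ^ 2 < |covarianceDefect (fun i => x i ω) θ θ|} ≤
      9 ^ k * (2 * Real.exp (-(n * t ^ 2 / (1152 * K ^ 4)))) := by
  obtain ⟨s, hcard, hs1, hs⟩ := exists_sphere_net W
  have hsub : {ω | ∃ θ ∈ W,
        max t (t ^ 2) * ‖θ‖ ^ 2 < |covarianceDefect (fun i => x i ω) θ θ|} ⊆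
      ⋃ y ∈ s, {ω | max t (t ^ 2) / 2 <
          |covarianceDefect (fun i => x i ω) (y : EuclideanSpace ℝ (Fin d)) y|} := by
    rintro ω ⟨θ, hθ, hlt⟩
    by_contra hcon
    simp only [Set.mem_iUnion, Set.mem_ofPred_eq, not_exists, not_lt] at hcon
    refine hlt.not_ge ?_
    exact abs_quad_le_of_submodule_net (covarianceDefect_isSymm _) hs1 hs hcon hθ
  refine (measureReal_mono hsub (measure_ne_top _ _)).trans
    ((measureReal_biUnion_finset_le _ _).trans ?_)
  refine (Finset.sum_le_card_nsmul _ _ _ fun y hy =>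
    measureReal_covarianceDefect_gt_le hn hK1 hx hind hiso hK ht (hs1 y hy)).trans ?_
  rw [nsmul_eq_mul]
  refine mul_le_mul_of_nonneg_right ?_ (by positivity)
  exact_mod_cast hcard.trans (Nat.pow_le_pow_right (by norm_num) hk)

theorem measureReal_exists_subspace_gt_le (hn : 1 ≤ n) (hK1 : 1 ≤ K)
    (hx : ∀ i, Measurable (x i)) (hind : iIndepFun x μ) (hiso : ∀ i, IsIsotropic (x i) μ)
    (hK : ∀ i, vectorPsi2Norm (x i) μ ≤ K) {t : ℝ} (ht : 0 ≤ t)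
    (𝒲 : Finset (Submodule ℝ (EuclideanSpace ℝ (Fin d)))) {k : ℕ}
    (hk : ∀ W ∈ 𝒲, Module.finrank ℝ W ≤ k) :
    μ.real {ω | ∃ W ∈ 𝒲, ∃ θ ∈ W,
        max t (t ^ 2) * ‖θ‖ ^ 2 < |covarianceDefect (fun i => x i ω) θ θ|} ≤
      𝒲.card * (9 ^ k * (2 * Real.exp (-(n * t ^ 2 / (1152 * K ^ 4))))) := by
  have hsub : {ω | ∃ W ∈ 𝒲, ∃ θ ∈ W,
        max t (t ^ 2) * ‖θ‖ ^ 2 < |covarianceDefect (fun i => x i ω) θ θ|} ⊆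
      ⋃ W ∈ 𝒲, {ω | ∃ θ ∈ W,
        max t (t ^ 2) * ‖θ‖ ^ 2 < |covarianceDefect (fun i => x i ω) θ θ|} := by
    rintro ω ⟨W, hW, h⟩
    exact Set.mem_biUnion hW h
  refine (measureReal_mono hsub (measure_ne_top _ _)).trans
    ((measureReal_biUnion_finset_le _ _).trans ?_)
  rw [← nsmul_eq_mul]
  exact Finset.sum_le_card_nsmul _ _ _ fun W hW =>
    measureReal_exists_mem_gt_le hn hK1 hx hind hiso hK ht W (hk W hW)

end Deviation

/-! ### The collections of partition subspaces -/

section Collections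

variable {d Q : ℕ}

theorem finrank_le_maxDim {U : Submodule ℝ (EuclideanSpace ℝ (Fin d))} (hU : U ∈ E1 d Q) :
    Module.finrank ℝ U ≤ maxDim d Q :=
  le_csSup ((E1_finite d Q).image _).bddAbove ⟨U, hU, rfl⟩

theorem one_le_numSubspaces (hQ : 1 ≤ Q) (hQd : Q ≤ d) : 1 ≤ numSubspaces d Q := by
  have hne : (E1 d Q).Nonempty := by
    obtain ⟨G, -, hG⟩ := Finpartition.exists_equipartition_card_eq
      (Finset.univ : Finset (Fin d)) (n := Q) (by omega) (by simpa using hQd)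
    exact ⟨_, G, hG, rfl⟩
  exact (Set.ncard_pos (E1_finite d Q)).2 hne

open Classical in
-- The cover is indexed by pairs of subspaces rather than of partitions, which is why `N` counts
-- `E1`.
theorem exists_finset_superset_E2 (d Q : ℕ) :
    ∃ 𝒲 : Finset (Submodule ℝ (EuclideanSpace ℝ (Fin d))), E2 d Q ⊆ 𝒲 ∧
      𝒲.card ≤ numSubspaces d Q ^ 2 ∧ ∀ W ∈ 𝒲, Module.finrank ℝ W ≤ 2 * maxDim d Q := by
  set S := (E1_finite d Q).toFinset with hS
  have hcard : S.card = numSubspaces d Q := (Set.ncard_eq_toFinset_card _ _).symm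
  refine ⟨(S ×ˢ S).image fun P => P.1 ⊔ P.2, ?_, ?_, ?_⟩
  · rintro _ ⟨G₁, h₁, G₂, h₂, rfl⟩
    simp only [Finset.coe_image, Set.mem_image]
    refine ⟨(partitionSubspace G₁, partitionSubspace G₂), ?_, rfl⟩
    simp only [Finset.coe_product, Set.mem_prod, hS, Set.Finite.coe_toFinset]
    exact ⟨⟨G₁, h₁, rfl⟩, ⟨G₂, h₂, rfl⟩⟩
  · refine Finset.card_image_le.trans_eq ?_
    rw [Finset.card_product, hcard, sq]
  · intro W hW
    obtain ⟨⟨U₁, U₂⟩, hU, rfl⟩ := Finset.mem_image.1 hW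
    simp only [Finset.mem_product, hS, Set.Finite.mem_toFinset] at hU
    have := Submodule.finrank_add_le_finrank_add_finrank U₁ U₂
    have := finrank_le_maxDim hU.1
    have := finrank_le_maxDim hU.2
    dsimp only
    omega

open Classical in
theorem exists_finset_superset_E3 (d Q : ℕ) :
    ∃ 𝒲 : Finset (Submodule ℝ (EuclideanSpace ℝ (Fin d))), E3 d Q ⊆ 𝒲 ∧
      𝒲.card ≤ numSubspaces d Q ^ 3 ∧ ∀ W ∈ 𝒲, Module.finrank ℝ W ≤ 3 * maxDim d Q := by
  obtain ⟨𝒱, h𝒱, hcardV, hdimV⟩ := exists_finset_superset_E2 d Q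
  set S := (E1_finite d Q).toFinset with hS
  have hcard : S.card = numSubspaces d Q := (Set.ncard_eq_toFinset_card _ _).symm
  refine ⟨(𝒱 ×ˢ S).image fun P => P.1 ⊔ P.2, ?_, ?_, ?_⟩
  · rintro _ ⟨G₁, h₁, G₂, h₂, G₃, h₃, rfl⟩
    simp only [Finset.coe_image, Set.mem_image]
    refine ⟨(partitionSubspace G₁ ⊔ partitionSubspace G₂, partitionSubspace G₃), ?_, rfl⟩
    simp only [Finset.coe_product, Set.mem_prod, hS, Set.Finite.coe_toFinset]
    exact ⟨h𝒱 ⟨G₁, h₁, G₂, h₂, rfl⟩, ⟨G₃, h₃, rfl⟩⟩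
  · refine Finset.card_image_le.trans ?_
    rw [Finset.card_product, hcard, pow_succ]
    gcongr
  · intro W hW
    obtain ⟨⟨U₁, U₂⟩, hU, rfl⟩ := Finset.mem_image.1 hW
    simp only [Finset.mem_product, hS, Set.Finite.mem_toFinset] at hU
    have := Submodule.finrank_add_le_finrank_add_finrank U₁ U₂
    have := hdimV _ hU.1
    have := finrank_le_maxDim hU.2
    dsimp only at *
    omega

theorem delta_nonneg {C₀ c : ℝ} (hC₀ : 0 ≤ C₀) (d Q n p : ℕ) : 0 ≤ delta C₀ c d Q n p := by
  unfold delta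
  positivity

/-- The entropy and net terms in `delta` absorb the size of a union bound over at most `N ^ p`
subspaces of dimension at most `p D`. -/
theorem union_bound_le_exp {a : ℝ} (ha : 0 < a) {n : ℕ} (p : ℕ) (hn : 1 ≤ n)
    (hN : 1 ≤ numSubspaces d Q) {ε : ℝ} (hε : 0 ≤ ε) :
    (numSubspaces d Q : ℝ) ^ p * (9 ^ (p * maxDim d Q) *
        (2 * Real.exp (-(n * (delta √(Real.log 9 / a) (a / 2) d Q n p + ε) ^ 2 * a)))) ≤
      Real.exp (-(a / 2) * ε ^ 2 * n) / 2 := by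
  have hn' : (0 : ℝ) < n := by exact_mod_cast hn
  set N : ℝ := (numSubspaces d Q : ℝ) with hNdef
  have hN' : 1 ≤ N := by rw [hNdef]; exact_mod_cast hN
  have hlogN : 0 ≤ Real.log N := Real.log_nonneg hN'
  have hlog9 : 0 < Real.log 9 := Real.log_pos (by norm_num)
  set D : ℝ := ((p * maxDim d Q : ℕ) : ℝ) with hD
  set u := √(Real.log 9 / a) * √(D / n) with hu
  set v := √((1 + p * Real.log N) / (a / 2 * n)) with hv
  have hdelta : delta √(Real.log 9 / a) (a / 2) d Q n p = u + v := by
    simp [delta, hu, hv, hD, hNdef]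
  have hu2 : n * u ^ 2 * a = D * Real.log 9 := by
    rw [hu, mul_pow, Real.sq_sqrt (by positivity), Real.sq_sqrt (by positivity)]
    field_simp
  have hv2 : n * v ^ 2 * a = 2 * (1 + p * Real.log N) := by
    rw [hv, Real.sq_sqrt (by positivity)]
    field_simp
  -- Here `u²` pays exactly for the net, `v²` for the `N ^ p` subspaces plus a spare constant `2`,
  -- and half of the `ε²` term is kept for the probability.
  have hexp : D * Real.log 9 + (2 + p * Real.log N) + a / 2 * ε ^ 2 * n ≤
      n * (u + v + ε) ^ 2 * a := by
    have hu0 : 0 ≤ u := by positivity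
    have hv0 : 0 ≤ v := by positivity
    have hsq : u ^ 2 + v ^ 2 + ε ^ 2 ≤ (u + v + ε) ^ 2 := by
      nlinarith [mul_nonneg hu0 hv0, mul_nonneg hu0 hε, mul_nonneg hv0 hε]
    have h1 : n * (u ^ 2 + v ^ 2 + ε ^ 2) * a ≤ n * (u + v + ε) ^ 2 * a := by gcongr
    have h2 : 0 ≤ a / 2 * ε ^ 2 * n := by positivity
    have h3 : 0 ≤ p * Real.log N := by positivity
    linarith
  -- The spare `exp (-2)` turns the two-sided factor `2` into `1/2`, so that the failure events for
  -- `E2` and `E3` together cost one exponential.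
  have he2 : Real.exp (-2) ≤ 1 / 4 := by
    rw [Real.exp_neg, show (2 : ℝ) = 1 + 1 by norm_num, Real.exp_add, ← one_div]
    apply one_div_le_one_div_of_le (by norm_num)
    nlinarith [Real.exp_one_gt_d9]
  have h9 : (9 : ℝ) ^ (p * maxDim d Q) = Real.exp (D * Real.log 9) := by
    rw [hD, Real.exp_nat_mul, Real.exp_log (by norm_num)]
  have hNp : N ^ p = Real.exp (p * Real.log N) := by
    rw [Real.exp_nat_mul, Real.exp_log (by linarith)]
  rw [hdelta, h9, hNp]
  calc _ ≤ Real.exp (p * Real.log N) * (Real.exp (D * Real.log 9) *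
        (2 * Real.exp (-(D * Real.log 9 + (2 + p * Real.log N) + a / 2 * ε ^ 2 * n)))) := by
        gcongr
    _ = 2 * (Real.exp (-2) * Real.exp (-(a / 2) * ε ^ 2 * n)) := by
        rw [← Real.exp_add (-2), mul_left_comm _ (2 : ℝ), mul_left_comm _ (2 : ℝ), ← Real.exp_add,
          ← Real.exp_add]
        congr 2
        ring
    _ ≤ 2 * (1 / 4 * Real.exp (-(a / 2) * ε ^ 2 * n)) := by gcongr
    _ = _ := by ring

end Collections

end ClusteredDesign

end

/-! ### Choice of constants and combination of the two failure events. -/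

theorem proposition2 (K : ℝ≥0) :
    ∃ C₀ c : ℝ, 0 < C₀ ∧ 0 < c ∧
      ∀ (d Q n : ℕ), 1 ≤ Q → Q ≤ d → 1 ≤ n →
      ∀ (Ω : Type u) [MeasurableSpace Ω] (μ : Measure Ω) [IsProbabilityMeasure μ]
        (x : Fin n → Ω → EuclideanSpace ℝ (Fin d)),
        (∀ i, Measurable (x i)) →
        iIndepFun x μ →
        (∀ i, IsIsotropic (x i) μ) →
        (∀ i, vectorPsi2Norm (x i) μ ≤ K) →
        ∀ ε : ℝ, 0 ≤ ε →
          1 - Real.exp (-c * ε ^ 2 * n) ≤ μ.real {ω |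
            (∀ U ∈ E2 d Q, ∀ (m : ℕ) (b : OrthonormalBasis (Fin m) ℝ U),
              1 / √(n : ℝ) * ‖designMatrix (fun i => x i ω) * basisMatrix b‖
                ≤ 1 + delta C₀ c d Q n 2 + ε) ∧
            (∀ U ∈ E3 d Q, ∀ (m : ℕ) (b : OrthonormalBasis (Fin m) ℝ U),
              ‖(1 : Matrix (Fin m) (Fin m) ℝ) - (1 / (n : ℝ)) •
                  ((basisMatrix b).transpose * (designMatrix (fun i => x i ω)).transpose *
                    designMatrix (fun i => x i ω) * basisMatrix b)‖
                ≤ 3 * max (delta C₀ c d Q n 3 + ε) ((delta C₀ c d Q n 3 + ε) ^ 2))} := by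
  -- The Bernstein bound needs a sub-gaussian constant of at least `1`, and enlarging `K` keeps the
  -- hypothesis true.
  set L : ℝ≥0 := max K 1 with hL
  have hL1 : 1 ≤ L := le_max_right _ _
  have hL0 : (0 : ℝ) < L := by exact_mod_cast zero_lt_one.trans_le hL1
  set a : ℝ := 1 / (1152 * L ^ 4) with ha
  have ha0 : 0 < a := by positivity
  have hlog9 : 0 < Real.log 9 := Real.log_pos (by norm_num)
  have hC₀ : 0 < √(Real.log 9 / a) := by positivity
  refine ⟨√(Real.log 9 / a), a / 2, hC₀, by positivity, ?_⟩
  intro d Q n hQ hQd hn Ω _ μ _ x hx hind hiso hK ε hε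
  have hKL (i) : vectorPsi2Norm (x i) μ ≤ L :=
    (hK i).trans (ENNReal.coe_le_coe.2 (le_max_left _ _))
  have hN := one_le_numSubspaces hQ hQd
  set δ := delta √(Real.log 9 / a) (a / 2) d Q n with hδ
  have ht (p) : 0 ≤ δ p + ε := add_nonneg (delta_nonneg hC₀.le _ _ _ _) hε
  have tail (p : ℕ) (𝒲 : Finset (Submodule ℝ (EuclideanSpace ℝ (Fin d))))
      (hcard : 𝒲.card ≤ numSubspaces d Q ^ p)
      (hdim : ∀ W ∈ 𝒲, Module.finrank ℝ W ≤ p * maxDim d Q) :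
      μ.real {ω | ∃ W ∈ 𝒲, ∃ θ ∈ W, max (δ p + ε) ((δ p + ε) ^ 2) * ‖θ‖ ^ 2 <
        |covarianceDefect (fun i => x i ω) θ θ|} ≤ Real.exp (-(a / 2) * ε ^ 2 * n) / 2 := by
    refine (measureReal_exists_subspace_gt_le hn hL1 hx hind hiso hKL (ht p) 𝒲 hdim).trans
      (le_trans ?_ (union_bound_le_exp ha0 p hn hN hε))
    rw [ha, mul_one_div]
    gcongr
    exact_mod_cast hcard
  obtain ⟨𝒱, h𝒱, hcard𝒱, hdim𝒱⟩ := exists_finset_superset_E2 d Q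
  obtain ⟨𝒲, h𝒲, hcard𝒲, hdim𝒲⟩ := exists_finset_superset_E3 d Q
  have tail2 := tail 2 𝒱 hcard𝒱 hdim𝒱
  have tail3 := tail 3 𝒲 hcard𝒲 hdim𝒲
  set F₂ := {ω | ∃ W ∈ 𝒱, ∃ θ ∈ W, max (δ 2 + ε) ((δ 2 + ε) ^ 2) * ‖θ‖ ^ 2 <
    |covarianceDefect (fun i => x i ω) θ θ|} with hF₂
  set F₃ := {ω | ∃ W ∈ 𝒲, ∃ θ ∈ W, max (δ 3 + ε) ((δ 3 + ε) ^ 2) * ‖θ‖ ^ 2 <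
    |covarianceDefect (fun i => x i ω) θ θ|} with hF₃
  set S := {ω | (∀ U ∈ E2 d Q, ∀ (m : ℕ) (b : OrthonormalBasis (Fin m) ℝ U),
      1 / √(n : ℝ) * ‖designMatrix (fun i => x i ω) * basisMatrix b‖ ≤ 1 + δ 2 + ε) ∧
    (∀ U ∈ E3 d Q, ∀ (m : ℕ) (b : OrthonormalBasis (Fin m) ℝ U),
      ‖(1 : Matrix (Fin m) (Fin m) ℝ) - (1 / (n : ℝ)) •
        ((basisMatrix b).transpose * (designMatrix (fun i => x i ω)).transpose *
          designMatrix (fun i => x i ω) * basisMatrix b)‖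
        ≤ 3 * max (δ 3 + ε) ((δ 3 + ε) ^ 2))} with hS
  -- Covering the whole space and using subadditivity bounds `μ.real S` from below without
  -- measurability of `S`.
  have hcover : Set.univ ⊆ S ∪ (F₂ ∪ F₃) := by
    intro ω _
    by_contra hω
    simp only [Set.mem_union, not_or] at hω
    obtain ⟨hωS, hω2, hω3⟩ := hω
    simp only [hF₂, hF₃, Set.mem_ofPred_eq, not_exists, not_and, not_lt] at hω2 hω3
    refine hωS ⟨fun U hU m b => ?_, fun U hU m b => ?_⟩
    · rw [add_assoc]
      exact norm_designMatrix_mul_basisMatrix_le hn _ b (ht 2) (hω2 U (h𝒱 hU))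
    · have h0 : 0 ≤ max (δ 3 + ε) ((δ 3 + ε) ^ 2) := (ht 3).trans (le_max_left _ _)
      -- The Gram bound holds with constant `1`; the factor `3` is slack.
      exact (norm_one_sub_gram_le _ b h0 (hω3 U (h𝒲 hU))).trans (by linarith)
  have h1 : 1 ≤ μ.real S + (μ.real F₂ + μ.real F₃) := by
    calc (1 : ℝ) = μ.real Set.univ := by simp
      _ ≤ μ.real (S ∪ (F₂ ∪ F₃)) := measureReal_mono hcover
      _ ≤ μ.real S + μ.real (F₂ ∪ F₃) := measureReal_union_le _ _
      _ ≤ _ := by gcongr; exact measureReal_union_le _ _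
  linarith
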